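/- Let $G$ and $H$ be locally compact, second countable, Hausdorff abelian groups, and let $\mathcal L\subseteq G\times H$ be a cocompact lattice (a discrete subgroup such that $\hat X:=(G\times H)/\mathcal L$ is compact) such that the projection $\pi^G:G\times H\to G$ is injective on $\mathcal L$ and the projection of $\mathcal L$ to $H$ is dense in $H$. Let $W\subseteq H$ be relatively compact. For $\hat x\in\hat X$ (a coset of $\mathcal L$) put $$\nu_W(\hat x):=\sum_{y\in \hat x\cap (G\times W)}\delta_y,\qquad \nu_W^G(\hat x):=\pi^G_*\nu_W(\hat x),$$ which are locally finite measures on $G\times H$ and on $G$. Let $\mathcal M_W$ be the vague closure of $\nu_W(\hat X)$ in the space of locally finite Borel measures on $G\times H$, and $\mathcal M_W^G$ the vague closure of $\nu^G_W(\hat X)$ in the space of locally finite Borel measures on $G$. The group $G$ acts on $\hat X$ by $\hat T_g\hat x=(g,0)+\hat x$, and on $\mathcal M_W$ and $\mathcal M_W^G$ by the translations $S$ (by $(g,0)$ and by $g$, respectively). A topological dynamical system is a jointly continuous action of $G$ on a compact Hausdorff space. A factor map is a continuous surjective equivariant map. The extension given by a factor map $\pi:X\to Y$ is almost 1-1 if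 the set of points of $Y$ with exactly one preimage contains a dense $G_\delta$-set. A system $(Y,T)$ is the maximal equicontinuous factor of $(X,S)$ with factor map $\pi$ if it is an equicontinuous factor via $\pi$ and every factor map from $(X,S)$ onto an equicontinuous system is of the form $\psi\circ\pi$ with a factor map $\psi$ defined on $(Y,T)$. Theorem. Assume that $\partial W$ is nowhere dense, and that $\operatorname{int}(\overline W)$ is non-empty and aperiodic, i.e. $h+\operatorname{int}(\overline W)=\operatorname{int}(\overline W)$ with $h\in H$ implies $h=0$. Then $(\hat X,\hat T)$, $(\mathcal M_W,S)$ and $(\mathcal M_W^G,S)$ are topological dynamical systems, and: a) $(\mathcal M_W,S)$ and $(\mathcal M^G_W,S)$ are topologically isomorphic, via the map $\nu\mapsto\pi^G_*\nu$, and both are almost 1-1 extensions of their maximal equicontinuous factor $(\hat X,\hat T)$. b) The factor map $\Gamma:\mathcal M_W^G\to\hat X$ in a) can be taken such that, for every non-empty closed $S$-invariant subset $M$ of $\mathcal M^G_W$, $(M,S)$ is an almost 1-1 extension of its maximal equicontinuous factor $(\hat X,\hat T)$ with factor map $\Gamma|_M$. -/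

import Mathlib

open MeasureTheory Topology Set Filter
open scoped CompactlySupported

universe u v w

set_option linter.unusedSectionVars false

/-! ## Topological dynamics -/

/-- `S` is a topological dynamical system: a jointly continuous action of the group `G`
on a compact Hausdorff space `X`. -/
structure IsTopDynSystem {G X : Type*} [AddGroup G] [TopologicalSpace G] [TopologicalSpace X]
    (S : G → X → X) : Prop where
  compact : CompactSpace X
  t2 : T2Space X
  zero_act : ∀ x, S 0 x = x
  add_act : ∀ g h x, S (g + h) x = S g (S h x)
  continuous_act : Continuous fun p : G × X => S p.1 p.2

/-- `π` is a factor map from `(X, S)` to `(Y, T)`; equivalently `(X, S)` is an extension of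
`(Y, T)` through `π`. -/
structure IsFactorMap {G X Y : Type*} [TopologicalSpace X] [TopologicalSpace Y]
    (S : G → X → X) (T : G → Y → Y) (π : X → Y) : Prop where
  continuous : Continuous π
  surjective : Function.Surjective π
  equivariant : ∀ g x, π (S g x) = T g (π x)

/-- `Φ` is a topological isomorphism of the systems `(X, S)` and `(Y, T)`. -/
structure IsTopIsomorphism {G X Y : Type*} [TopologicalSpace X] [TopologicalSpace Y]
    (S : G → X → X) (T : G → Y → Y) (Φ : X → Y) : Prop where
  isHomeomorph : IsHomeomorph Φ
  equivariant : ∀ g x, Φ (S g x) = T g (Φ x)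

/-- `(X, S)` is an almost 1-1 extension of `(Y, T)` with factor map `π`: the set of points of `Y`
with exactly one preimage contains a dense `Gδ` set. -/
structure IsAlmostOneToOneExtension {G X Y : Type*} [TopologicalSpace X] [TopologicalSpace Y]
    (S : G → X → X) (T : G → Y → Y) (π : X → Y) : Prop where
  isFactorMap : IsFactorMap S T π
  residual_singleton_fibres : ∃ D : Set Y, IsGδ D ∧ Dense D ∧ ∀ y ∈ D, ∃! x, π x = y

/-- The family of maps `S g` is uniformly equicontinuous for a uniformity inducing the topology
(on a compact Hausdorff space there is exactly one such uniformity). -/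
def IsEquicontinuousAction {G X : Type*} [t : TopologicalSpace X] (S : G → X → X) : Prop :=
  ∃ u : UniformSpace X, u.toTopologicalSpace = t ∧ UniformEquicontinuous S

/-- `(Y, T)` is the maximal equicontinuous factor of `(X, S)`, with factor map `π`: it is an
equicontinuous factor, and every equicontinuous factor of `(X, S)` is a factor of `(Y, T)`
in such a way that the factor maps commute. -/
structure IsMaximalEquicontinuousFactor {G X Y : Type*} [AddGroup G] [TopologicalSpace G]
    [TopologicalSpace X] [TopologicalSpace Y]
    (S : G → X → X) (T : G → Y → Y) (π : X → Y) : Prop where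
  isTopDynSystem : IsTopDynSystem T
  isFactorMap : IsFactorMap S T π
  equicontinuous : IsEquicontinuousAction T
  maximal : ∀ (Z : Type w) [TopologicalSpace Z] (R : G → Z → Z) (φ : X → Z),
    IsTopDynSystem R → IsEquicontinuousAction R → IsFactorMap S R φ →
      ∃ ψ : Y → Z, IsFactorMap T R ψ ∧ φ = ψ ∘ π

/-- A subset of an abelian group is aperiodic if only the trivial translation fixes it. -/
def IsAperiodic {H : Type*} [AddGroup H] (A : Set H) : Prop :=
  ∀ h : H, (fun x => h + x) '' A = A → h = 0

/-! ## Locally finite measures and the vague topology -/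

/-- The locally finite Borel measures on `X`. -/
def LFMeasure (X : Type*) [TopologicalSpace X] [MeasurableSpace X] : Type _ :=
  {μ : Measure X // IsLocallyFiniteMeasure μ}

/-- The vague topology: the coarsest topology for which `μ ↦ ∫ f ∂μ` is continuous for every
compactly supported continuous function `f`. -/
noncomputable instance LFMeasure.instTopologicalSpace (X : Type*) [TopologicalSpace X] [MeasurableSpace X] :
    TopologicalSpace (LFMeasure X) :=
  TopologicalSpace.induced (fun μ (f : C_c(X, ℝ)) => ∫ x, f x ∂μ.1) Pi.topologicalSpace

lemma LFMeasure.continuous_integral {X : Type*} [TopologicalSpace X] [MeasurableSpace X]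
    (f : C_c(X, ℝ)) : Continuous fun μ : LFMeasure X => ∫ x, f x ∂μ.1 :=
  (continuous_apply f).comp (continuous_induced_dom (t := Pi.topologicalSpace)
    (f := fun (μ : LFMeasure X) (f : C_c(X, ℝ)) => ∫ x, f x ∂μ.1))

section Translation

variable {A : Type*} [AddGroup A] [TopologicalSpace A] [IsTopologicalAddGroup A]
  [MeasurableSpace A] [BorelSpace A]

lemma isLocallyFiniteMeasure_map_add (a : A) (μ : Measure A) (hμ : IsLocallyFiniteMeasure μ) :
    IsLocallyFiniteMeasure (μ.map fun x => a + x) := by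
  refine ⟨fun x => ?_⟩
  obtain ⟨U, hxU, hU, hfin⟩ := hμ.1 (-a + x) |>.exists_mem_basis (nhds_basis_opens _) |>.imp
    fun U h => (⟨h.1.1, h.1.2, h.2⟩ : _ ∧ _ ∧ _)
  refine ⟨(fun y => -a + y) ⁻¹' U, (hU.preimage (by fun_prop)).mem_nhds hxU, ?_⟩
  have hm : Measurable fun x : A => a + x :=
    (continuous_const.add continuous_id : Continuous fun x : A => a + x).measurable
  rw [Measure.map_apply hm (hU.preimage (by fun_prop)).measurableSet]
  simpa [preimage_preimage] using hfin

/-- Translation of a locally finite measure: `(translate a μ) B = μ (-a + B)`. -/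
noncomputable def LFMeasure.translate (a : A) (μ : LFMeasure A) : LFMeasure A :=
  ⟨μ.1.map fun x => a + x, isLocallyFiniteMeasure_map_add a μ.1 μ.2⟩

lemma LFMeasure.continuous_translate (a : A) :
    Continuous (LFMeasure.translate a : LFMeasure A → LFMeasure A) := by
  refine continuous_induced_rng.2 (continuous_pi fun f => ?_)
  have h : Continuous fun μ : LFMeasure A =>
      ∫ x, (f.comp ⟨⟨fun y => a + y, by fun_prop⟩,
        (Homeomorph.addLeft a).isClosedEmbedding.tendsto_cocompact⟩) x ∂μ.1 :=
    LFMeasure.continuous_integral _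
  refine h.congr fun μ => ?_
  exact ((Homeomorph.addLeft a).measurableEmbedding.integral_map f).symm

end Translation

/-! ## Weak model sets -/

section ModelSet

variable {G H : Type*} [AddCommGroup G] [AddCommGroup H]

/-- The translation action of `G` on the torus `(G × H) ⧸ L`. -/
def torusAct (L : AddSubgroup (G × H)) (g : G) (x : (G × H) ⧸ L) : (G × H) ⧸ L :=
  (((g, 0) : G × H) : (G × H) ⧸ L) + x

variable [MeasurableSpace G] [MeasurableSpace H]

/-- The configuration `∑ δ_y`, summed over the points `y` of the coset `x` of `L` that lie in
`G × W`. -/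
noncomputable def nuW (L : AddSubgroup (G × H)) (W : Set H) (x : (G × H) ⧸ L) :
    Measure (G × H) :=
  Measure.sum fun y : {y : G × H // (y : (G × H) ⧸ L) = x ∧ y.2 ∈ W} => Measure.dirac y.1

/-- The projection of the configuration to `G`. -/
noncomputable def nuWG (L : AddSubgroup (G × H)) (W : Set H) (x : (G × H) ⧸ L) : Measure G :=
  (nuW L W x).map Prod.fst

variable [TopologicalSpace G] [TopologicalSpace H]

/-- The vague closure of the set of all configurations `nuW L W x`. (These measures are locally
finite when `L` is discrete, see `isLocallyFiniteMeasure_nuW`.) -/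
def MW (L : AddSubgroup (G × H)) (W : Set H) : Set (LFMeasure (G × H)) :=
  closure {μ | ∃ x : (G × H) ⧸ L, μ.1 = nuW L W x}

/-- The vague closure of the set of all projected configurations `nuWG L W x`. (These measures are
locally finite when `L` is discrete and `W` is relatively compact, see
`isLocallyFiniteMeasure_nuWG`.) -/
def MWG (L : AddSubgroup (G × H)) (W : Set H) : Set (LFMeasure G) :=
  closure {μ | ∃ x : (G × H) ⧸ L, μ.1 = nuWG L W x}

variable [IsTopologicalAddGroup G] [IsTopologicalAddGroup H] [T2Space G] [T2Space H]
  [LocallyCompactSpace G] [LocallyCompactSpace H]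
  [SecondCountableTopology G] [SecondCountableTopology H] [BorelSpace G] [BorelSpace H]

lemma finite_coset_inter_compact (L : AddSubgroup (G × H)) [DiscreteTopology L]
    (x : (G × H) ⧸ L) {K : Set (G × H)} (hK : IsCompact K) :
    {y : G × H | (y : (G × H) ⧸ L) = x ∧ y ∈ K}.Finite := by
  obtain ⟨x₀, rfl⟩ := QuotientAddGroup.mk_surjective x
  have hL : IsClosed (L : Set (G × H)) := AddSubgroup.isClosed_of_discrete
  have hK' : IsCompact ((fun y => -x₀ + y) '' K) := hK.image (by fun_prop)
  have hfin : ((L : Set (G × H)) ∩ (fun y => -x₀ + y) '' K).Finite := by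
    have h1 : IsCompact ((Subtype.val : L → G × H) ⁻¹' ((fun y => -x₀ + y) '' K)) :=
      hL.isClosedEmbedding_subtypeVal.isCompact_preimage hK'
    refine (h1.finite_of_discrete.image Subtype.val).subset ?_
    rintro z ⟨hzL, hz⟩
    exact ⟨⟨z, hzL⟩, hz, rfl⟩
  refine (hfin.preimage (f := fun y => -x₀ + y) (add_right_injective _).injOn).subset ?_
  rintro y ⟨hy, hyK⟩
  exact ⟨QuotientAddGroup.eq.1 hy.symm, y, hyK, rfl⟩

lemma nuW_lt_top (L : AddSubgroup (G × H)) [DiscreteTopology L] (W : Set H)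
    (x : (G × H) ⧸ L) {B K : Set (G × H)} (hB : MeasurableSet B) (hK : IsCompact K)
    (hBK : ∀ y ∈ B, y.2 ∈ W → y ∈ K) : nuW L W x B < ⊤ := by
  have hfin := finite_coset_inter_compact L x hK
  set s : Set {y : G × H // (y : (G × H) ⧸ L) = x ∧ y.2 ∈ W} := {y | y.1 ∈ K} with hs
  have hsf : s.Finite :=
    (hfin.preimage Subtype.val_injective.injOn).subset fun y hy => ⟨y.2.1, hy⟩
  rw [nuW, Measure.sum_apply _ hB, tsum_eq_sum (s := hsf.toFinset)]
  · refine ENNReal.sum_lt_top.2 fun y _ => ?_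
    exact measure_lt_top _ _
  · intro y hy
    rw [Measure.dirac_apply' _ hB, indicator_of_notMem]
    exact fun hyB => hy (by simpa [hs] using hBK y.1 hyB y.2.2)

lemma isLocallyFiniteMeasure_nuW (L : AddSubgroup (G × H)) [DiscreteTopology L] (W : Set H)
    (x : (G × H) ⧸ L) : IsLocallyFiniteMeasure (nuW L W x) := by
  refine ⟨fun p => ?_⟩
  obtain ⟨K, hK, hpK⟩ := exists_compact_mem_nhds p
  exact ⟨K, hpK, nuW_lt_top L W x hK.measurableSet hK fun y hy _ => hy⟩

lemma isLocallyFiniteMeasure_nuWG (L : AddSubgroup (G × H)) [DiscreteTopology L] (W : Set H)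
    (hW : IsCompact (closure W)) (x : (G × H) ⧸ L) : IsLocallyFiniteMeasure (nuWG L W x) := by
  refine ⟨fun p => ?_⟩
  obtain ⟨K, hK, hpK⟩ := exists_compact_mem_nhds p
  refine ⟨K, hpK, ?_⟩
  rw [nuWG, Measure.map_apply measurable_fst hK.measurableSet]
  exact nuW_lt_top L W x (measurable_fst hK.measurableSet) (hK.prod hW)
    fun y hy hyW => ⟨hy, subset_closure hyW⟩

lemma nuW_map_add (L : AddSubgroup (G × H)) (W : Set H) (g : G) (x : (G × H) ⧸ L) :
    (nuW L W x).map (fun y => ((g, 0) : G × H) + y) = nuW L W (torusAct L g x) := by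
  have hm : Measurable fun y : G × H => ((g, 0) : G × H) + y :=
    (by fun_prop : Continuous fun y : G × H => ((g, 0) : G × H) + y).measurable
  let e : {y : G × H // (y : (G × H) ⧸ L) = x ∧ y.2 ∈ W} ≃
      {y : G × H // (y : (G × H) ⧸ L) = torusAct L g x ∧ y.2 ∈ W} :=
    (Equiv.addLeft ((g, 0) : G × H)).subtypeEquiv fun y => by
      simp [torusAct]
  rw [nuW, nuW, ← Measure.sum_comp_equiv e]
  ext B hB
  rw [Measure.map_apply hm hB, Measure.sum_apply _ (hm hB), Measure.sum_apply _ hB]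
  refine tsum_congr fun y => ?_
  rw [Measure.dirac_apply' _ (hm hB)]
  exact (Measure.dirac_apply' _ hB).symm

lemma translate_mem_MW (L : AddSubgroup (G × H)) (W : Set H) (g : G) :
    MapsTo (LFMeasure.translate ((g, 0) : G × H)) (MW L W) (MW L W) := by
  refine MapsTo.closure ?_ (LFMeasure.continuous_translate _)
  rintro μ ⟨x, hx⟩
  exact ⟨torusAct L g x, by rw [← nuW_map_add, ← hx]; rfl⟩

lemma translate_mem_MWG (L : AddSubgroup (G × H)) (W : Set H) (g : G) :
    MapsTo (LFMeasure.translate g) (MWG L W) (MWG L W) := by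
  refine MapsTo.closure ?_ (LFMeasure.continuous_translate _)
  rintro μ ⟨x, hx⟩
  refine ⟨torusAct L g x, ?_⟩
  have hm : Measurable fun y : G × H => ((g, 0) : G × H) + y :=
    (by fun_prop : Continuous fun y : G × H => ((g, 0) : G × H) + y).measurable
  have hg : Measurable fun y : G => g + y :=
    (by fun_prop : Continuous fun y : G => g + y).measurable
  rw [nuWG, ← nuW_map_add, Measure.map_map measurable_fst hm]
  change μ.1.map (fun y => g + y) = _
  rw [hx, nuWG, Measure.map_map hg measurable_fst]
  rfl

/-- The translation action of `G` on `MW L W`. -/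
noncomputable def actMW (L : AddSubgroup (G × H)) (W : Set H) (g : G) : MW L W → MW L W :=
  (translate_mem_MW L W g).restrict

/-- The translation action of `G` on `MWG L W`. -/
noncomputable def actMWG (L : AddSubgroup (G × H)) (W : Set H) (g : G) : MWG L W → MWG L W :=
  (translate_mem_MWG L W g).restrict

end ModelSet

/-!
The theorem rests on attaching to each `ν` in `MW L W` a point of the torus `(G × H) ⧸ L`. A vague
limit of configurations `nuW L W xᵢ` is, by compactness of the torus, squeezed between the
configurations of a single coset `x` for the windows `interior W` and `closure W`
(`IsLimitConfiguration`, `exists_isLimitConfiguration`). Since the frontier of `W` is nowhere dense,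
`interior W` is nonempty, so every coset meets `G × interior W` and `ν` has an atom, which
determines `x`. The resulting map `ν ↦ x` is continuous because its graph is closed in a compact space. If
`x` does not meet `G × frontier W` then the two windows give the same configuration and the fibre
over `x` is a singleton; by Baire's theorem these `x` form a dense `Gδ` set
(`exists_isAlmostOneToOneExtension_torus`). Compactness of `MW L W` comes from the uniform bound on
the number of points of a coset in a compact set and the Riesz–Markov–Kakutani theorem
(`LFMeasure.isCompact_setOf_abs_integral_le`).

The projection to `G` is injective on `MW L W` (`eq_of_map_fst_eq`): two limit configurations with
the same projection belong to cosets `x` and `x + (0, h)`, and comparing atoms, with `L` injective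
over `G` and dense in `H`, shows that translation by `h` and by `-h` map `interior (closure W)` into
itself, so `h = 0` by aperiodicity. A continuous injection of a compact space into a Hausdorff space
is a homeomorphism onto its image, and the image is `MWG L W`.

Finally, the torus is a minimal equicontinuous system, and such a system is the maximal
equicontinuous factor of any extension with a singleton fibre: two points in one fibre can be moved
simultaneously close to the point of the singleton fibre, so their images under a factor map onto an
equicontinuous system are proximal, hence equal (`IsFactorMap.apply_eq_of_apply_eq`). Minimality
also makes every nonempty closed invariant subset project onto the torus, so that the same reasoning
applies to it.
-/

/-! ### Extensions of minimal equicontinuous systems -/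

section Dynamics

variable {G X Y : Type*} [AddGroup G] [TopologicalSpace G] [TopologicalSpace X]
  [TopologicalSpace Y] {S : G → X → X} {T : G → Y → Y}

/-- Equicontinuous group actions are distal: two points whose translates by a common group element
can be brought into any given entourage coincide. -/
lemma eq_of_forall_exists_act_mem {Z : Type*} [UniformSpace Z] [T0Space Z] {R : G → Z → Z}
    (h0 : ∀ z, R 0 z = z) (hadd : ∀ g h z, R (g + h) z = R g (R h z))
    (hR : UniformEquicontinuous R) {z z' : Z}
    (h : ∀ V ∈ uniformity Z, ∃ g, (R g z, R g z') ∈ V) : z = z' := by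
  refine eq_of_uniformity fun {V} hV => ?_
  have hU := hR V hV
  obtain ⟨g, hg⟩ := h _ hU
  have := hg (-g)
  simpa [← hadd, h0] using this

/-- Two points in the same fibre over a minimal system are mapped to the same point by every factor
map onto an equicontinuous system, as soon as one fibre is a singleton: their orbits can be brought
simultaneously close to the point of the singleton fibre. -/
lemma IsFactorMap.apply_eq_of_apply_eq {Z : Type*} [TopologicalSpace Z] [CompactSpace X] [T2Space Y]
    {π : X → Y} (hπ : IsFactorMap S T π)
    (hT : ∀ y, Dense (range fun g => T g y)) {y₀ : Y} (hy₀ : ∃! x, π x = y₀)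
    {R : G → Z → Z} {φ : X → Z} (hR : IsTopDynSystem R) (hRe : IsEquicontinuousAction R)
    (hφ : IsFactorMap S R φ) {x x' : X} (hx : π x = π x') : φ x = φ x' := by
  obtain ⟨u, rfl, hu⟩ := hRe
  have := hR.t2
  obtain ⟨p, hp, hpu⟩ := hy₀
  refine eq_of_forall_exists_act_mem hR.zero_act hR.add_act hu fun V hV => ?_
  obtain ⟨U, hU, hUs, hUV⟩ := comp_symm_mem_uniformity_sets hV
  have hN : φ ⁻¹' UniformSpace.ball (φ p) U ∈ 𝓝 p :=
    hφ.continuous.continuousAt (UniformSpace.ball_mem_nhds _ hU)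
  obtain ⟨N, hNs, hNo, hpN⟩ := mem_nhds_iff.1 hN
  -- the complement of the image of the closed set `Nᶜ` is a neighbourhood of `y₀`
  have hcl : IsClosed (π '' Nᶜ) := (hNo.isClosed_compl.isCompact.image hπ.continuous).isClosed
  have hy : y₀ ∈ (π '' Nᶜ)ᶜ := by
    rintro ⟨q, hq, rfl⟩
    exact hq (hpu q rfl ▸ hpN)
  obtain ⟨_, hg, g, rfl⟩ := (hT (π x)).inter_open_nonempty _ hcl.isOpen_compl ⟨_, hy⟩
  have key : ∀ q, π q = π x → (φ p, R g (φ q)) ∈ U := by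
    intro q hq
    have : S g q ∈ N := by
      by_contra hn
      exact hg ⟨S g q, hn, by rw [hπ.equivariant, hq]⟩
    rw [← hφ.equivariant]
    exact hNs this
  refine ⟨g, hUV (SetRel.prodMk_mem_comp ?_ (key x' hx.symm))⟩
  exact hUs.symm _ _ (key x rfl)

/-- A minimal equicontinuous system is the maximal equicontinuous factor of each of its extensions
that has a singleton fibre. -/
lemma IsFactorMap.isMaximalEquicontinuousFactor [CompactSpace X]
    {π : X → Y} (hπ : IsFactorMap S T π) (hTd : IsTopDynSystem T) (hTe : IsEquicontinuousAction T)
    (hT : ∀ y, Dense (range fun g => T g y)) {y₀ : Y} (hy₀ : ∃! x, π x = y₀) :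
    IsMaximalEquicontinuousFactor.{w} S T π where
  isTopDynSystem := hTd
  isFactorMap := hπ
  equicontinuous := hTe
  maximal := by
    intro Z _ R φ hR hRe hφ
    have := hTd.t2
    have hq : IsQuotientMap π :=
      (hπ.continuous.isClosedMap).isQuotientMap hπ.continuous hπ.surjective
    obtain ⟨σ, hσ⟩ := hπ.surjective.hasRightInverse
    have hfac : φ = (φ ∘ σ) ∘ π := by
      ext x
      exact hπ.apply_eq_of_apply_eq hT hy₀ hR hRe hφ (hσ (π x)).symm
    refine ⟨φ ∘ σ, ⟨?_, ?_, ?_⟩, hfac⟩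
    · rw [hq.continuous_iff, ← hfac]
      exact hφ.continuous
    · intro z
      obtain ⟨x, rfl⟩ := hφ.surjective z
      exact ⟨π x, (congrFun hfac x).symm⟩
    · intro g y
      obtain ⟨x, rfl⟩ := hπ.surjective y
      rw [← hπ.equivariant]
      have h1 := congrFun hfac (S g x)
      have h2 := congrFun hfac x
      simp only [Function.comp_apply] at h1 h2 ⊢
      rw [← h1, ← h2, hφ.equivariant]

/-- A minimal equicontinuous system is the maximal equicontinuous factor of each of its almost 1-1
extensions. -/
lemma IsAlmostOneToOneExtension.isMaximalEquicontinuousFactor [CompactSpace X] [Nonempty Y]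
    {π : X → Y} (hπ : IsAlmostOneToOneExtension S T π) (hTd : IsTopDynSystem T)
    (hTe : IsEquicontinuousAction T) (hT : ∀ y, Dense (range fun g => T g y)) :
    IsMaximalEquicontinuousFactor.{w} S T π := by
  obtain ⟨hf, D, -, hDd, hD⟩ := hπ
  obtain ⟨y₀, hy₀⟩ := hDd.nonempty
  exact hf.isMaximalEquicontinuousFactor hTd hTe hT (hD y₀ hy₀)

/-- Restrictions of an almost 1-1 extension of a minimal system to nonempty closed invariant
subsets are again almost 1-1 extensions. -/
lemma IsAlmostOneToOneExtension.restrict [CompactSpace X] [T2Space Y]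
    {π : X → Y} (hπ : IsAlmostOneToOneExtension S T π)
    (hT : ∀ y, Dense (range fun g => T g y)) {M : Set X} (hM : ∀ g, MapsTo (S g) M M)
    (hne : M.Nonempty) (hcl : IsClosed M) :
    IsAlmostOneToOneExtension (fun g => (hM g).restrict) T (M.domRestrict π) := by
  obtain ⟨hf, D, hDG, hDd, hD⟩ := hπ
  have hsurj : Function.Surjective (M.domRestrict π) := by
    -- the image of `M` is closed and contains an orbit
    have hc : IsClosed (π '' M) := (hcl.isCompact.image hf.continuous).isClosed
    obtain ⟨m, hm⟩ := hne
    have : closure (range fun g => T g (π m)) ⊆ π '' M := by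
      refine hc.closure_subset_iff.2 ?_
      rintro _ ⟨g, rfl⟩
      exact ⟨S g m, hM g hm, hf.equivariant g m⟩
    intro y
    obtain ⟨x, hx, rfl⟩ := this (hT (π m) y)
    exact ⟨⟨x, hx⟩, rfl⟩
  refine ⟨⟨hf.continuous.comp continuous_subtype_val, hsurj, fun g x => hf.equivariant g x⟩,
    D, hDG, hDd, fun y hy => ?_⟩
  obtain ⟨x, hx⟩ := hsurj y
  exact ⟨x, hx, fun x' hx' => Subtype.ext ((hD y hy).unique hx' hx)⟩

/-- Almost 1-1 extensions can be transported along topological isomorphisms. -/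
lemma IsTopIsomorphism.isAlmostOneToOneExtension_symm {X' : Type*} [TopologicalSpace X']
    {S' : G → X' → X'} {Φ : X → X'} (hΦ : IsTopIsomorphism S S' Φ) {π : X → Y}
    (hπ : IsAlmostOneToOneExtension S T π) :
    ∃ π' : X' → Y, IsAlmostOneToOneExtension S' T π' := by
  obtain ⟨hf, D, hDG, hDd, hD⟩ := hπ
  let e := hΦ.isHomeomorph.homeomorph
  have he : ∀ x, Φ (e.symm x) = x := e.apply_symm_apply
  refine ⟨π ∘ e.symm, ⟨hf.continuous.comp e.symm.continuous, hf.surjective.comp e.symm.surjective,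
    fun g x => ?_⟩, D, hDG, hDd, fun y hy => ?_⟩
  · simp only [Function.comp_apply]
    rw [← hf.equivariant]
    congr 1
    apply e.injective
    change Φ _ = Φ _
    rw [he, hΦ.equivariant, he]
  · obtain ⟨x, hx, hu⟩ := hD y hy
    refine ⟨e x, by simpa using hx, fun x' hx' => ?_⟩
    rw [← hu _ hx', e.apply_symm_apply]

end Dynamics

/-! ### The torus -/

section Torus

variable {G H : Type*} [AddCommGroup G] [TopologicalSpace G] [IsTopologicalAddGroup G]
  [AddCommGroup H] [TopologicalSpace H] [IsTopologicalAddGroup H]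

lemma isTopDynSystem_torusAct [T2Space G] [T2Space H] (L : AddSubgroup (G × H))
    [DiscreteTopology L] [CompactSpace ((G × H) ⧸ L)] : IsTopDynSystem (torusAct L) where
  compact := inferInstance
  t2 := by
    have : IsClosed (L : Set (G × H)) := AddSubgroup.isClosed_of_discrete
    infer_instance
  zero_act x := by
    change (((0 : G × H) : G × H) : (G × H) ⧸ L) + x = x
    simp
  add_act g h x := by
    rw [torusAct, torusAct, torusAct, ← add_assoc, ← QuotientAddGroup.mk_add]
    simp
  continuous_act := by
    have : Continuous fun g : G => (((g, 0) : G × H) : (G × H) ⧸ L) :=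
      QuotientAddGroup.continuous_mk.comp (by fun_prop)
    exact (this.comp continuous_fst).add continuous_snd

lemma isEquicontinuousAction_torusAct (L : AddSubgroup (G × H)) :
    IsEquicontinuousAction (torusAct L) := by
  let u : UniformSpace ((G × H) ⧸ L) := IsTopologicalAddGroup.rightUniformSpace _
  have : IsUniformAddGroup ((G × H) ⧸ L) := isUniformAddGroup_of_addCommGroup
  refine ⟨u, rfl, ?_⟩
  intro V hV
  rw [uniformity_eq_comap_nhds_zero] at hV ⊢
  obtain ⟨U, hU, hUV⟩ := hV
  refine ⟨U, hU, ?_⟩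
  rintro ⟨x, y⟩ hxy g
  apply hUV
  simpa [torusAct] using hxy

lemma dense_range_torusAct (L : AddSubgroup (G × H))
    (hLH : Dense ((Prod.snd : G × H → H) '' (L : Set (G × H)))) (x : (G × H) ⧸ L) :
    Dense (range fun g => torusAct L g x) := by
  have hd : Dense (range fun g : G => (((g, 0) : G × H) : (G × H) ⧸ L)) := by
    have h1 : Dense ((univ : Set G) ×ˢ ((Prod.snd : G × H → H) '' (L : Set (G × H)))) :=
      dense_univ.prod hLH
    have h2 := (QuotientAddGroup.mk_surjective (s := L)).denseRange.dense_image
      QuotientAddGroup.continuous_mk h1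
    refine h2.mono ?_
    rintro _ ⟨⟨g, _⟩, ⟨-, l, hl, rfl⟩, rfl⟩
    refine ⟨g - l.1, QuotientAddGroup.eq.2 ?_⟩
    have : -((g - l.1, 0) : G × H) + (g, l.2) = l := by ext <;> simp
    rwa [this]
  have := (Homeomorph.addRight x).surjective.denseRange.dense_image
    (Homeomorph.addRight x).continuous hd
  rw [← range_comp] at this
  exact this

end Torus

/-! ### The vague topology -/

section Vague

variable {X : Type*} [TopologicalSpace X] [T2Space X] [LocallyCompactSpace X]

lemma exists_compactlySupported_eq_one {K U : Set X} (hK : IsCompact K) (hU : IsOpen U)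
    (hKU : K ⊆ U) : ∃ χ : C_c(X, ℝ), (∀ x ∈ K, χ x = 1) ∧ tsupport χ ⊆ U ∧
      (∀ x, 0 ≤ χ x) ∧ ∀ x, χ x ≤ 1 := by
  obtain ⟨χ, h1, hc, hs, h01⟩ := exists_continuousMap_one_of_isCompact_subset_isOpen hK hU hKU
  exact ⟨⟨χ, hc⟩, fun x hx => h1 hx, hs, fun x => (h01 x).1, fun x => (h01 x).2⟩

variable [SecondCountableTopology X] [MeasurableSpace X] [BorelSpace X]

instance LFMeasure.isLocallyFiniteMeasure (μ : LFMeasure X) : IsLocallyFiniteMeasure μ.1 := μ.2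

lemma LFMeasure.integrable (μ : LFMeasure X) (f : C_c(X, ℝ)) : Integrable f μ.1 :=
  f.continuous.integrable_of_hasCompactSupport f.hasCompactSupport

instance LFMeasure.t2Space : T2Space (LFMeasure X) := by
  refine T2Space.of_injective_continuous (f := fun (μ : LFMeasure X) (f : C_c(X, ℝ)) =>
    ∫ x, f x ∂μ.1) (fun μ ν h => Subtype.ext ?_) continuous_induced_dom
  exact Measure.ext_of_integral_eq_on_compactlySupported fun f => congrFun h f

/-- Vague compactness: the image of such a set of measures in `C_c(X, ℝ) → ℝ` consists, by the
Riesz–Markov–Kakutani theorem, of all positive linear functionals in a product of compact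
intervals. -/
lemma LFMeasure.isCompact_setOf_abs_integral_le (C : C_c(X, ℝ) → ℝ) :
    IsCompact {μ : LFMeasure X | ∀ f : C_c(X, ℝ), |∫ x, f x ∂μ.1| ≤ C f} := by
  have hind : IsInducing fun (μ : LFMeasure X) (f : C_c(X, ℝ)) => ∫ x, f x ∂μ.1 := ⟨rfl⟩
  rw [hind.isCompact_iff]
  have hbox : IsCompact (univ.pi fun f : C_c(X, ℝ) => Icc (-C f) (C f)) :=
    isCompact_univ_pi fun _ => isCompact_Icc
  have hadd : IsClosed {Λ : C_c(X, ℝ) → ℝ | ∀ f g, Λ (f + g) = Λ f + Λ g} := by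
    simp only [ofPred_forall]
    exact isClosed_iInter fun f => isClosed_iInter fun g =>
      isClosed_eq (by fun_prop) (by fun_prop)
  have hsmul : IsClosed {Λ : C_c(X, ℝ) → ℝ | ∀ (c : ℝ) f, Λ (c • f) = c * Λ f} := by
    simp only [ofPred_forall]
    exact isClosed_iInter fun c => isClosed_iInter fun f =>
      isClosed_eq (by fun_prop) (by fun_prop)
  have hpos : IsClosed {Λ : C_c(X, ℝ) → ℝ | ∀ f, 0 ≤ f → 0 ≤ Λ f} := by
    simp only [ofPred_forall]
    exact isClosed_iInter fun f => isClosed_iInter fun _ =>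
      isClosed_le (by fun_prop) (by fun_prop)
  convert ((hbox.inter_right hadd).inter_right hsmul).inter_right hpos using 1
  ext Λ
  constructor
  · rintro ⟨μ, hμ, rfl⟩
    refine ⟨⟨⟨fun f _ => abs_le.1 (hμ f), fun f g => ?_⟩, fun c f => ?_⟩, fun f hf => ?_⟩
    · exact integral_add (μ.integrable f) (μ.integrable g)
    · exact integral_const_mul c _
    · exact integral_nonneg hf
  · rintro ⟨⟨⟨h1, h2⟩, h3⟩, h4⟩
    let Λ' : C_c(X, ℝ) →ₚ[ℝ] ℝ := PositiveLinearMap.mk₀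
      { toFun := Λ, map_add' := h2, map_smul' := h3 } h4
    have hΛ : ∀ f, ∫ x, f x ∂(RealRMK.rieszMeasure Λ') = Λ f := fun f =>
      RealRMK.integral_rieszMeasure Λ' f
    refine ⟨⟨RealRMK.rieszMeasure Λ', inferInstance⟩, fun f => ?_, funext hΛ⟩
    simp only [hΛ]
    exact abs_le.2 (h1 f (mem_univ f))

lemma measure_eq_zero_of_integral_eq_zero (μ : Measure X) [IsLocallyFiniteMeasure μ] {U : Set X}
    (hU : IsOpen U) (h : ∀ f : C_c(X, ℝ), tsupport f ⊆ U → ∫ x, f x ∂μ = 0) : μ U = 0 := by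
  rw [hU.measure_eq_iSup_isCompact]
  simp only [ENNReal.iSup_eq_zero]
  intro K hKU hK
  obtain ⟨χ, h1, hs, h0, -⟩ := exists_compactlySupported_eq_one hK hU hKU
  have h2 := h χ hs
  rw [integral_eq_zero_iff_of_nonneg h0
    (χ.continuous.integrable_of_hasCompactSupport χ.hasCompactSupport)] at h2
  refine measure_mono_null (fun x hx => ?_) (ae_iff.1 h2)
  simp [h1 x hx]

/-- Two measures that are carried by a countable set and agree on its points are equal. -/
lemma measure_ext_of_countable {μ ν : Measure X} {A : Set X} (hA : A.Countable)
    (hμ : μ Aᶜ = 0) (hν : ν Aᶜ = 0) (h : ∀ a ∈ A, μ {a} = ν {a}) : μ = ν := by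
  ext B -
  have key : ∀ ρ : Measure X, ρ Aᶜ = 0 → ρ B = ∑' a : (B ∩ A : Set X), ρ {a.1} := by
    intro ρ hρ
    have h1 : ρ B = ρ (B ∩ A) := (measure_inter_conull hρ).symm
    rw [h1, ← measure_biUnion (hA.mono inter_subset_right)
      (fun a _ b _ hab => by simpa using hab) (fun a _ => measurableSet_singleton a),
      biUnion_of_singleton]
  rw [key μ hμ, key ν hν]
  exact tsum_congr fun a => h a.1 a.2.2

end Vague

section VagueTranslation

variable {A : Type*} [AddGroup A] [TopologicalSpace A] [IsTopologicalAddGroup A] [T2Space A]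
  [LocallyCompactSpace A] [SecondCountableTopology A] [MeasurableSpace A] [BorelSpace A]

lemma LFMeasure.integral_translate (a : A) (μ : LFMeasure A) (f : A → ℝ) :
    ∫ x, f x ∂(LFMeasure.translate a μ).1 = ∫ x, f (a + x) ∂μ.1 :=
  (Homeomorph.addLeft a).measurableEmbedding.integral_map f

lemma LFMeasure.translate_zero (μ : LFMeasure A) : LFMeasure.translate 0 μ = μ :=
  Subtype.ext (by simp [LFMeasure.translate])

lemma LFMeasure.translate_add (a b : A) (μ : LFMeasure A) :
    LFMeasure.translate (a + b) μ = LFMeasure.translate a (LFMeasure.translate b μ) := by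
  refine Subtype.ext ?_
  simp only [LFMeasure.translate]
  rw [Measure.map_map (by fun_prop) (by fun_prop)]
  congr 1
  ext x
  simp [add_assoc]

/-- On a vaguely compact set of measures the masses of a compact set are uniformly bounded, so that
the integrals of nearby translates of a test function are uniformly close. -/
lemma LFMeasure.continuous_translate_of_isCompact {K : Set (LFMeasure A)} (hK : IsCompact K) :
    Continuous fun p : A × K => LFMeasure.translate p.1 p.2.1 := by
  refine continuous_induced_rng.2 (continuous_pi fun f => ?_)
  simp only [Function.comp_def, LFMeasure.integral_translate]
  rw [continuous_iff_continuousAt]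
  rintro ⟨a₀, μ₀⟩
  obtain ⟨V, hV, haV⟩ := exists_compact_mem_nhds a₀
  have hQ : IsCompact ((fun p : A × A => -p.1 + p.2) '' V ×ˢ tsupport f) :=
    (hV.prod f.hasCompactSupport).image (by fun_prop)
  set Q := (fun p : A × A => -p.1 + p.2) '' V ×ˢ tsupport f
  have hfQ : ∀ a ∈ V, ∀ x ∉ Q, f (a + x) = 0 := by
    intro a ha x hx
    refine image_eq_zero_of_notMem_tsupport fun h => hx ⟨(a, a + x), ⟨ha, h⟩, ?_⟩
    simp
  obtain ⟨χ, h1, -, h0, -⟩ := exists_compactlySupported_eq_one hQ isOpen_univ (subset_univ _)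
  obtain ⟨C, hC⟩ := hK.exists_bound_of_continuousOn (LFMeasure.continuous_integral χ).continuousOn
  have hCpos : 0 < |C| + 1 := by positivity
  have hint : ∀ a (μ : LFMeasure A), Integrable (fun x => f (a + x)) μ.1 := fun a μ =>
    (Homeomorph.addLeft a).measurableEmbedding.integrable_map_iff.1
      ((LFMeasure.translate a μ).integrable f)
  have hfix : Continuous fun μ : K => ∫ x, f (a₀ + x) ∂μ.1.1 := by
    simp only [← LFMeasure.integral_translate]
    exact (LFMeasure.continuous_integral f).comp
      ((LFMeasure.continuous_translate a₀).comp continuous_subtype_val)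
  rw [ContinuousAt, Metric.tendsto_nhds]
  intro ε hε
  have hδ : 0 < ε / 2 / (|C| + 1) := by positivity
  have hev : ∀ᶠ a in 𝓝 a₀, ∀ x ∈ Q, |f (a + x) - f (a₀ + x)| < ε / 2 / (|C| + 1) := by
    refine hQ.eventually_forall_of_forall_eventually fun x _ => ?_
    have hc : Continuous fun z : A × A => |f (z.1 + z.2) - f (a₀ + z.2)| := by
      have := f.continuous
      fun_prop
    have := hc.tendsto (a₀, x)
    simp only [sub_self, abs_zero] at this
    exact this.eventually (gt_mem_nhds hδ)
  have hev2 := (Metric.tendsto_nhds.1 (hfix.tendsto μ₀)) (ε / 2) (by positivity)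
  rw [nhds_prod_eq]
  filter_upwards [(hev.and haV).prod_mk hev2] with ⟨a, μ⟩ ⟨⟨ha, haV'⟩, hμ⟩
  simp only at ha haV' hμ ⊢
  have hb : ∀ x, ‖f (a + x) - f (a₀ + x)‖ ≤ ε / 2 / (|C| + 1) * χ x := by
    intro x
    by_cases hx : x ∈ Q
    · rw [h1 x hx, mul_one]
      exact (ha x hx).le
    · rw [hfQ a haV' x hx, hfQ a₀ (mem_of_mem_nhds haV) x hx]
      simpa using mul_nonneg hδ.le (h0 x)
  have hle : dist (∫ x, f (a + x) ∂μ.1.1) (∫ x, f (a₀ + x) ∂μ.1.1) < ε / 2 := by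
    rw [dist_eq_norm, ← integral_sub (hint a μ.1) (hint a₀ μ.1)]
    refine (norm_integral_le_of_norm_le ((μ.1.integrable χ).const_mul _)
      (Eventually.of_forall hb)).trans_lt ?_
    rw [integral_const_mul]
    have hCμ : ∫ x, χ x ∂μ.1.1 < |C| + 1 :=
      ((le_abs_self _).trans (hC μ.1 μ.2)).trans_lt ((le_abs_self C).trans_lt (lt_add_one _))
    calc _ < ε / 2 / (|C| + 1) * (|C| + 1) := by gcongr
      _ = ε / 2 := by field_simp
  calc _ ≤ _ := dist_triangle _ (∫ x, f (a₀ + x) ∂μ.1.1) _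
    _ < ε / 2 + ε / 2 := add_lt_add hle hμ
    _ = ε := add_halves ε

end VagueTranslation

/-! ### Configurations and their vague limits -/

section Configurations

variable {G H : Type*} [AddCommGroup G] [AddCommGroup H]
  [MeasurableSpace G] [MeasurableSpace H] [TopologicalSpace G] [TopologicalSpace H]

/-- The properties that survive when configurations of points converging to `x` converge vaguely
to `μ`: the measure `μ` vanishes off `x ∩ (G × closure W)`, has mass at least one at each point of
`x ∩ (G × interior W)`, and has mass at most one on each open set that contains at most one point of
every coset. They are expressed through test functions, in such a way that they define a closed set
of pairs `(x, μ)`. -/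
structure IsLimitConfiguration (L : AddSubgroup (G × H)) (W : Set H) (x : (G × H) ⧸ L)
    (μ : LFMeasure (G × H)) : Prop where
  integral_eq_zero : ∀ f : C_c(G × H, ℝ),
    x ∉ (QuotientAddGroup.mk : G × H → (G × H) ⧸ L) '' (tsupport f ∩ Prod.snd ⁻¹' closure W) →
      ∫ y, f y ∂μ.1 = 0
  le_integral : ∀ f : C_c(G × H, ℝ), (∀ y, 0 ≤ f y) → ∀ c : ℝ,
    x ∈ (QuotientAddGroup.mk : G × H → (G × H) ⧸ L) '' ({y | c < f y} ∩ Prod.snd ⁻¹' interior W) →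
      c ≤ ∫ y, f y ∂μ.1
  integral_le_one : ∀ f : C_c(G × H, ℝ), (∀ y, 0 ≤ f y) → (∀ y, f y ≤ 1) →
    InjOn (QuotientAddGroup.mk : G × H → (G × H) ⧸ L) (Function.support f) → ∫ y, f y ∂μ.1 ≤ 1

variable [IsTopologicalAddGroup G] [IsTopologicalAddGroup H] [T2Space G] [T2Space H]
  [LocallyCompactSpace G] [LocallyCompactSpace H]
  [SecondCountableTopology G] [SecondCountableTopology H] [BorelSpace G] [BorelSpace H]
  {L : AddSubgroup (G × H)} {W : Set H} {x : (G × H) ⧸ L}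

instance t2Space_quotient_of_discrete [DiscreteTopology L] : T2Space ((G × H) ⧸ L) := by
  have : IsClosed (L : Set (G × H)) := AddSubgroup.isClosed_of_discrete
  infer_instance

lemma countable_coset [DiscreteTopology L] (x : (G × H) ⧸ L) :
    {y : G × H | (y : (G × H) ⧸ L) = x}.Countable := by
  have : Countable L := countable_of_Lindelof_of_discrete
  obtain ⟨x₀, rfl⟩ := QuotientAddGroup.mk_surjective x
  refine (countable_range fun l : L => x₀ + l).mono fun y hy => ?_
  exact ⟨⟨-x₀ + y, QuotientAddGroup.eq.1 hy.symm⟩, by simp⟩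

instance countable_coset_subtype [DiscreteTopology L] (x : (G × H) ⧸ L) (W : Set H) :
    Countable {y : G × H // (y : (G × H) ⧸ L) = x ∧ y.2 ∈ W} :=
  ((countable_coset x).mono fun _ hy => hy.1 :
    {y : G × H | (y : (G × H) ⧸ L) = x ∧ y.2 ∈ W}.Countable).to_subtype

/-- The quotient map by a discrete subgroup is locally injective. -/
lemma exists_isOpen_injOn_mk [DiscreteTopology L] (p : G × H) :
    ∃ V : Set (G × H), IsOpen V ∧ p ∈ V ∧ InjOn (QuotientAddGroup.mk : G × H → (G × H) ⧸ L) V := by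
  obtain ⟨U, hU, hUL⟩ := isOpen_induced_iff.1 (isOpen_discrete ({0} : Set L))
  have h0 : (0 : G × H) ∈ U := by
    have : (0 : L) ∈ Subtype.val ⁻¹' U := hUL ▸ mem_singleton _
    exact this
  have hc : Continuous fun q : (G × H) × (G × H) => -q.1 + q.2 := by fun_prop
  have : (fun q : (G × H) × (G × H) => -q.1 + q.2) ⁻¹' U ∈ 𝓝 (p, p) :=
    hc.continuousAt.preimage_mem_nhds (by simpa using hU.mem_nhds h0)
  obtain ⟨V, hV, hpV, hVU⟩ := exists_nhds_square this
  refine ⟨V, hV, hpV, fun y hy z hz hyz => ?_⟩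
  have h1 : (⟨-y + z, QuotientAddGroup.eq.1 hyz⟩ : L) ∈ Subtype.val ⁻¹' U :=
    hVU (mk_mem_prod hy hz)
  rw [hUL] at h1
  have h2 : -y + z = 0 := congrArg Subtype.val h1
  exact neg_add_eq_zero.1 h2

lemma nuW_apply_le_one (W : Set H) (x : (G × H) ⧸ L) {B : Set (G × H)} (hB : MeasurableSet B)
    (hinj : InjOn (QuotientAddGroup.mk : G × H → (G × H) ⧸ L) B) : nuW L W x B ≤ 1 := by
  rw [nuW, Measure.sum_apply _ hB]
  simp only [Measure.dirac_apply' _ hB]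
  by_cases h : ∃ y : {y : G × H // (y : (G × H) ⧸ L) = x ∧ y.2 ∈ W}, y.1 ∈ B
  · obtain ⟨y, hy⟩ := h
    rw [tsum_eq_single y]
    · exact indicator_le_self' (by simp) _
    · intro z hz
      refine indicator_of_notMem (fun hzB => hz ?_) _
      exact Subtype.ext (hinj hzB hy (z.2.1.trans y.2.1.symm))
  · push Not at h
    simp [h]

lemma nuW_apply_le_of_isCompact [DiscreteTopology L] {K : Set (G × H)} (hK : IsCompact K) :
    ∃ N : ℕ, ∀ (W : Set H) (x : (G × H) ⧸ L), nuW L W x K ≤ N := by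
  choose V hVo hpV hV using exists_isOpen_injOn_mk (L := L)
  obtain ⟨t, ht⟩ := hK.elim_finite_subcover V hVo fun p _ => mem_iUnion.2 ⟨p, hpV p⟩
  refine ⟨t.card, fun W x => ?_⟩
  calc nuW L W x K ≤ nuW L W x (⋃ p ∈ t, V p) := measure_mono ht
    _ ≤ ∑ p ∈ t, nuW L W x (V p) := measure_biUnion_finset_le _ _
    _ ≤ ∑ p ∈ t, 1 := Finset.sum_le_sum fun p _ =>
        nuW_apply_le_one W x (hVo p).measurableSet (hV p)
    _ = t.card := by simp

lemma exists_abs_integral_nuW_le [DiscreteTopology L] (f : C_c(G × H, ℝ)) :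
    ∃ C : ℝ, ∀ (W : Set H) (x : (G × H) ⧸ L), |∫ y, f y ∂(nuW L W x)| ≤ C := by
  obtain ⟨N, hN⟩ := nuW_apply_le_of_isCompact (L := L) f.hasCompactSupport
  obtain ⟨M, hM⟩ := f.continuous.bounded_above_of_compact_support f.hasCompactSupport
  refine ⟨M * N, fun W x => ?_⟩
  have hlt : nuW L W x (tsupport f) < ⊤ := (hN W x).trans_lt (ENNReal.natCast_lt_top N)
  rw [← setIntegral_eq_integral_of_forall_compl_eq_zero (s := tsupport f)
    fun y hy => image_eq_zero_of_notMem_tsupport hy]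
  refine (norm_setIntegral_le_of_norm_le_const hlt fun y _ => hM y).trans ?_
  have : (nuW L W x).real (tsupport f) ≤ N := by
    have := ENNReal.toReal_mono (ENNReal.natCast_ne_top N) (hN W x)
    simpa [Measure.real] using this
  exact mul_le_mul_of_nonneg_left this ((norm_nonneg _).trans (hM 0))

lemma isCompact_MW [DiscreteTopology L] (W : Set H) : IsCompact (MW L W) := by
  choose C hC using exists_abs_integral_nuW_le (L := L)
  have hK := LFMeasure.isCompact_setOf_abs_integral_le C
  refine hK.of_isClosed_subset isClosed_closure (hK.isClosed.closure_subset_iff.2 ?_)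
  rintro μ ⟨x, hx⟩ f
  rw [hx]
  exact hC f W x

lemma isLimitConfiguration_of_eq_nuW [DiscreteTopology L] (W : Set H) (x : (G × H) ⧸ L)
    {μ : LFMeasure (G × H)} (hμ : μ.1 = nuW L W x) : IsLimitConfiguration L W x μ where
  integral_eq_zero f hf := by
    refine integral_eq_zero_of_ae ?_
    rw [hμ, nuW, EventuallyEq, Measure.ae_sum_iff]
    intro y
    rw [ae_dirac_eq]
    refine image_eq_zero_of_notMem_tsupport fun hy => hf ⟨y.1, ⟨hy, ?_⟩, y.2.1⟩
    exact subset_closure y.2.2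
  le_integral := by
    rintro f hf c ⟨y, ⟨hc, hy⟩, hyx⟩
    have hle : Measure.dirac y ≤ μ.1 := by
      rw [hμ, nuW]
      exact Measure.le_sum (fun y : {y : G × H // (y : (G × H) ⧸ L) = x ∧ y.2 ∈ W} =>
        Measure.dirac y.1) ⟨y, hyx, interior_subset hy⟩
    have := integral_mono_measure hle (Eventually.of_forall hf) (μ.integrable f)
    rw [integral_dirac] at this
    exact (le_of_lt hc).trans this
  integral_le_one f hf0 hf1 hinj := by
    have ho : MeasurableSet (Function.support f) := f.continuous.isOpen_support.measurableSet
    have hb : μ.1 (Function.support f) ≤ 1 := hμ ▸ nuW_apply_le_one W x ho hinj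
    have hb' : μ.1.real (Function.support f) ≤ 1 := by
      simpa [Measure.real] using ENNReal.toReal_mono ENNReal.one_ne_top hb
    rw [← setIntegral_eq_integral_of_forall_compl_eq_zero (s := Function.support f)
      fun y hy => Function.notMem_support.1 hy]
    have hn : ∀ y ∈ Function.support f, ‖f y‖ ≤ 1 := fun y _ => by
      rw [Real.norm_eq_abs, abs_of_nonneg (hf0 y)]
      exact hf1 y
    have := norm_setIntegral_le_of_norm_le_const (hb.trans_lt ENNReal.one_lt_top) hn
    rw [one_mul] at this
    exact (le_abs_self _).trans (this.trans hb')

lemma isClosed_setOf_isLimitConfiguration [DiscreteTopology L] :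
    IsClosed {p : ((G × H) ⧸ L) × LFMeasure (G × H) | IsLimitConfiguration L W p.1 p.2} := by
  have hint : ∀ f : C_c(G × H, ℝ),
      Continuous fun p : ((G × H) ⧸ L) × LFMeasure (G × H) => ∫ y, f y ∂p.2.1 :=
    fun f => (LFMeasure.continuous_integral f).comp continuous_snd
  have h1 : IsClosed {p : ((G × H) ⧸ L) × LFMeasure (G × H) | ∀ f : C_c(G × H, ℝ),
      p.1 ∉ (QuotientAddGroup.mk : G × H → (G × H) ⧸ L) '' (tsupport f ∩ Prod.snd ⁻¹' closure W) →
      ∫ y, f y ∂p.2.1 = 0} := by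
    simp only [ofPred_forall]
    refine isClosed_iInter fun f => isClosed_imp ?_ (isClosed_eq (hint f) continuous_const)
    have : IsCompact (tsupport f ∩ Prod.snd ⁻¹' closure W) :=
      f.hasCompactSupport.isCompact.inter_right (isClosed_closure.preimage continuous_snd)
    exact (this.image QuotientAddGroup.continuous_mk).isClosed.isOpen_compl.preimage continuous_fst
  have h2 : IsClosed {p : ((G × H) ⧸ L) × LFMeasure (G × H) | ∀ f : C_c(G × H, ℝ),
      (∀ y, 0 ≤ f y) → ∀ c : ℝ, p.1 ∈ (QuotientAddGroup.mk : G × H → (G × H) ⧸ L) ''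
        ({y | c < f y} ∩ Prod.snd ⁻¹' interior W) → c ≤ ∫ y, f y ∂p.2.1} := by
    simp only [ofPred_forall]
    refine isClosed_iInter fun f => isClosed_iInter fun _ => isClosed_iInter fun c =>
      isClosed_imp ?_ (isClosed_le continuous_const (hint f))
    exact (QuotientAddGroup.isOpenMap_coe _ ((isOpen_lt continuous_const f.continuous).inter
      (isOpen_interior.preimage continuous_snd))).preimage continuous_fst
  have h3 : IsClosed {p : ((G × H) ⧸ L) × LFMeasure (G × H) | ∀ f : C_c(G × H, ℝ),
      (∀ y, 0 ≤ f y) → (∀ y, f y ≤ 1) →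
      InjOn (QuotientAddGroup.mk : G × H → (G × H) ⧸ L) (Function.support f) →
        ∫ y, f y ∂p.2.1 ≤ 1} := by
    simp only [ofPred_forall]
    exact isClosed_iInter fun f => isClosed_iInter fun _ => isClosed_iInter fun _ =>
      isClosed_iInter fun _ => isClosed_le (hint f) continuous_const
  convert (h1.inter h2).inter h3 using 1
  ext p
  exact ⟨fun h => ⟨⟨h.1, h.2⟩, h.3⟩, fun h => ⟨h.1.1, h.1.2, h.2⟩⟩

lemma exists_isLimitConfiguration [DiscreteTopology L] [CompactSpace ((G × H) ⧸ L)]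
    {μ : LFMeasure (G × H)} (hμ : μ ∈ MW L W) :
    ∃ x : (G × H) ⧸ L, IsLimitConfiguration L W x μ := by
  have hc := isClosedMap_snd_of_compactSpace _ 
    (isClosed_setOf_isLimitConfiguration (L := L) (W := W))
  have : MW L W ⊆ Prod.snd '' {p : ((G × H) ⧸ L) × LFMeasure (G × H) |
      IsLimitConfiguration L W p.1 p.2} := by
    refine hc.closure_subset_iff.2 ?_
    rintro ν ⟨x, hx⟩
    exact ⟨(x, ν), isLimitConfiguration_of_eq_nuW W x hx, rfl⟩
  obtain ⟨⟨x, _⟩, hx, rfl⟩ := this hμ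
  exact ⟨x, hx⟩

namespace IsLimitConfiguration

variable {μ : LFMeasure (G × H)}

lemma measure_compl [DiscreteTopology L] (h : IsLimitConfiguration L W x μ) :
    μ.1 {y : G × H | (y : (G × H) ⧸ L) = x ∧ y.2 ∈ closure W}ᶜ = 0 := by
  have hcl : IsClosed {y : G × H | (y : (G × H) ⧸ L) = x ∧ y.2 ∈ closure W} :=
    (isClosed_singleton.preimage QuotientAddGroup.continuous_mk).inter
      (isClosed_closure.preimage continuous_snd)
  refine measure_eq_zero_of_integral_eq_zero μ.1 hcl.isOpen_compl fun f hf => ?_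
  refine h.integral_eq_zero f ?_
  rintro ⟨y, ⟨hy, hyW⟩, hyx⟩
  exact hf hy ⟨hyx, hyW⟩

lemma mem_of_measure_ne_zero [DiscreteTopology L] (h : IsLimitConfiguration L W x μ)
    {B : Set (G × H)} (hB : μ.1 B ≠ 0) :
    ∃ y ∈ B, (y : (G × H) ⧸ L) = x ∧ y.2 ∈ closure W := by
  by_contra! hn
  refine hB (measure_mono_null ?_ h.measure_compl)
  exact fun y hy hy' => hn y hy hy'.1 hy'.2

lemma measure_singleton [DiscreteTopology L] (h : IsLimitConfiguration L W x μ) {y : G × H}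
    (hyx : (y : (G × H) ⧸ L) = x) (hyW : y.2 ∈ interior W) : μ.1 {y} = 1 := by
  obtain ⟨V, hV, hyV, hinj⟩ := exists_isOpen_injOn_mk (L := L) y
  obtain ⟨χ, h1, hs, h0, hle⟩ := exists_compactlySupported_eq_one isCompact_singleton hV
    (singleton_subset_iff.2 hyV)
  have hy1 : χ y = 1 := h1 y rfl
  -- `y` is the only point of `x` in the support of `χ`
  have hint : ∫ z, χ z ∂μ.1 = μ.1.real {y} := by
    rw [← integral_indicator_one (measurableSet_singleton y)]
    refine integral_congr_ae ?_
    filter_upwards [compl_mem_ae_iff.2 h.measure_compl] with z hz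
    simp only [compl_compl] at hz
    by_cases hzy : z = y
    · simp [hzy, hy1]
    · rw [indicator_of_notMem (by simpa using hzy)]
      refine image_eq_zero_of_notMem_tsupport fun hzs => hzy ?_
      exact hinj (hs hzs) hyV (hz.1.trans hyx.symm)
  have hle1 : ∫ z, χ z ∂μ.1 ≤ 1 :=
    h.integral_le_one χ h0 hle (hinj.mono ((subset_tsupport _).trans hs))
  have hge1 : 1 ≤ ∫ z, χ z ∂μ.1 := by
    refine le_of_forall_lt_imp_le_of_dense fun c hc => ?_
    exact h.le_integral χ h0 c ⟨y, ⟨by simpa [hy1] using hc, hyW⟩, hyx⟩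
  have := le_antisymm hle1 hge1
  rw [hint, Measure.real] at this
  rwa [ENNReal.toReal_eq_one_iff] at this

end IsLimitConfiguration

/-- Since `L` projects densely to `H`, so does every coset of `L`. -/
lemma exists_mem_coset_snd_mem (hLH : Dense ((Prod.snd : G × H → H) '' (L : Set (G × H))))
    (x : (G × H) ⧸ L) {U : Set H} (hU : IsOpen U) (hne : U.Nonempty) :
    ∃ y : G × H, (y : (G × H) ⧸ L) = x ∧ y.2 ∈ U := by
  obtain ⟨x₀, rfl⟩ := QuotientAddGroup.mk_surjective x
  obtain ⟨u, hu⟩ := hne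
  obtain ⟨_, hl, l, hlL, rfl⟩ := hLH.inter_open_nonempty ((fun h => x₀.2 + h) ⁻¹' U)
    (hU.preimage (by fun_prop)) ⟨-x₀.2 + u, by simpa using hu⟩
  refine ⟨x₀ + l, ?_, hl⟩
  rw [eq_comm, QuotientAddGroup.eq]
  simpa using hlL

/-- A limit configuration determines the point of the torus it belongs to, because it has an atom
in `G × interior W`. -/
lemma IsLimitConfiguration.unique [DiscreteTopology L]
    (hLH : Dense ((Prod.snd : G × H → H) '' (L : Set (G × H)))) (hne : (interior W).Nonempty)
    {μ : LFMeasure (G × H)} {x' : (G × H) ⧸ L} (h : IsLimitConfiguration L W x μ)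
    (h' : IsLimitConfiguration L W x' μ) : x = x' := by
  obtain ⟨y, hyx, hyW⟩ := exists_mem_coset_snd_mem hLH x isOpen_interior hne
  have h1 : μ.1 {y} ≠ 0 := by
    rw [h.measure_singleton hyx hyW]
    exact one_ne_zero
  obtain ⟨z, rfl, hz, -⟩ := h'.mem_of_measure_ne_zero h1
  exact hyx.symm.trans hz

/-- The points of the torus for which the coset does not meet `G × frontier W` form a dense `Gδ`
set, by Baire's theorem in `G × H`. -/
lemma isGδ_dense_setOf_notMem_frontier [DiscreteTopology L] (hW : IsCompact (closure W))
    (hbd : IsNowhereDense (frontier W)) :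
    IsGδ {x : (G × H) ⧸ L | ∀ y : G × H, (y : (G × H) ⧸ L) = x → y.2 ∉ frontier W} ∧
      Dense {x : (G × H) ⧸ L | ∀ y : G × H, (y : (G × H) ⧸ L) = x → y.2 ∉ frontier W} := by
  have hfc : IsCompact (frontier W) := hW.of_isClosed_subset isClosed_frontier
    frontier_subset_closure
  constructor
  · have : {x : (G × H) ⧸ L | ∀ y : G × H, (y : (G × H) ⧸ L) = x → y.2 ∉ frontier W} =
        ⋂ n : ℕ, ((QuotientAddGroup.mk : G × H → (G × H) ⧸ L) ''
          (compactCovering G n ×ˢ frontier W))ᶜ := by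
      ext x
      simp only [mem_ofPred_eq, mem_iInter, mem_compl_iff]
      constructor
      · rintro h n ⟨y, ⟨-, hy⟩, hyx⟩
        exact h y hyx hy
      · intro h y hyx hy
        obtain ⟨n, hn⟩ := exists_mem_compactCovering y.1
        exact h n ⟨y, ⟨hn, hy⟩, hyx⟩
    rw [this]
    refine IsGδ.iInter_of_isOpen fun n => ?_
    exact ((((isCompact_compactCovering G n).prod hfc).image
      QuotientAddGroup.continuous_mk).isClosed).isOpen_compl
  · have : Countable L := countable_of_Lindelof_of_discrete
    have hfd : Dense (frontier W)ᶜ := by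
      rw [← interior_eq_empty_iff_dense_compl]
      simpa [IsNowhereDense, isClosed_frontier.closure_eq] using hbd
    have hd : Dense (⋂ l : L, (fun y : G × H => y + l) ⁻¹' (Prod.snd ⁻¹' (frontier W)ᶜ)) := by
      refine dense_iInter_of_isOpen (fun l => ?_) fun l => ?_
      · exact (isClosed_frontier.isOpen_compl.preimage continuous_snd).preimage (by fun_prop)
      · have h1 : Dense ((Prod.snd : G × H → H) ⁻¹' (frontier W)ᶜ) :=
          hfd.preimage isOpenMap_snd
        exact h1.preimage (Homeomorph.addRight (l : G × H)).isOpenMap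
    refine ((QuotientAddGroup.mk_surjective (s := L)).denseRange.dense_image
      QuotientAddGroup.continuous_mk hd).mono ?_
    rintro _ ⟨z, hz, rfl⟩ y hyz
    have := mem_iInter.1 hz ⟨-z + y, QuotientAddGroup.eq.1 hyz.symm⟩
    simpa using this

lemma interior_closure_subset_closure_interior {W : Set H} (hbd : IsNowhereDense (frontier W)) :
    interior (closure W) ⊆ closure (interior W) := by
  have hfd : interior (frontier W) = ∅ := by
    simpa [IsNowhereDense, isClosed_frontier.closure_eq] using hbd
  intro h hh
  rw [mem_closure_iff]
  intro U hU hhU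
  by_contra hn
  have hsub : U ∩ interior (closure W) ⊆ frontier W := fun z hz =>
    ⟨interior_subset hz.2, fun hzW => hn ⟨z, hz.1, hzW⟩⟩
  have := interior_maximal hsub (hU.inter isOpen_interior) ⟨hhU, hh⟩
  rw [hfd] at this
  exact this

end Configurations

section Hulls

variable {G H : Type*} [AddCommGroup G] [AddCommGroup H]
  [MeasurableSpace G] [MeasurableSpace H] [TopologicalSpace G] [TopologicalSpace H]
  [IsTopologicalAddGroup G] [IsTopologicalAddGroup H] [T2Space G] [T2Space H]
  [LocallyCompactSpace G] [LocallyCompactSpace H]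
  [SecondCountableTopology G] [SecondCountableTopology H] [BorelSpace G] [BorelSpace H]
  {L : AddSubgroup (G × H)} {W : Set H} {x : (G × H) ⧸ L}

/-! ### The system `MW` and its torus parametrization -/

lemma isTopDynSystem_actMW [DiscreteTopology L] (W : Set H) : IsTopDynSystem (actMW L W) where
  compact := isCompact_iff_compactSpace.1 (isCompact_MW W)
  t2 := inferInstance
  zero_act ν := Subtype.ext (LFMeasure.translate_zero ν.1)
  add_act g g' ν := Subtype.ext <| by
    change LFMeasure.translate ((g + g', 0) : G × H) ν.1 =
      LFMeasure.translate (g, 0) (LFMeasure.translate (g', 0) ν.1)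
    rw [← LFMeasure.translate_add]
    simp
  continuous_act := by
    refine Continuous.subtype_mk ?_ _
    have hg : Continuous fun p : G × MW L W => (((p.1, 0) : G × H), p.2) := by fun_prop
    exact (LFMeasure.continuous_translate_of_isCompact (isCompact_MW W)).comp hg

/-- The configuration of a point of the torus, as a point of `MW L W`. -/
noncomputable def configuration [DiscreteTopology L] (W : Set H) (x : (G × H) ⧸ L) : MW L W :=
  ⟨⟨nuW L W x, isLocallyFiniteMeasure_nuW L W x⟩, subset_closure ⟨x, rfl⟩⟩

lemma denseRange_configuration [DiscreteTopology L] (W : Set H) :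
    DenseRange (configuration W : (G × H) ⧸ L → MW L W) := by
  refine Subtype.dense_iff.2 (closure_mono ?_)
  rintro μ ⟨x, hx⟩
  exact ⟨configuration W x, mem_range_self x, Subtype.ext hx.symm⟩

lemma actMW_configuration [DiscreteTopology L] (W : Set H) (g : G) (x : (G × H) ⧸ L) :
    actMW L W g (configuration W x) = configuration W (torusAct L g x) :=
  Subtype.ext (Subtype.ext (nuW_map_add L W g x))

/-- The map sending a limit configuration to the point of the torus it belongs to is continuous
because its graph is closed and the torus is compact. The points of the torus whose coset does not
meet `G × frontier W` have singleton fibres. -/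
lemma exists_isAlmostOneToOneExtension_torus [DiscreteTopology L] [CompactSpace ((G × H) ⧸ L)]
    (hLH : Dense ((Prod.snd : G × H → H) '' (L : Set (G × H))))
    (hW : IsCompact (closure W)) (hbd : IsNowhereDense (frontier W))
    (hne : (interior W).Nonempty) :
    ∃ γ : MW L W → (G × H) ⧸ L, IsAlmostOneToOneExtension (actMW L W) (torusAct L) γ := by
  choose γ hγ using fun ν : MW L W => exists_isLimitConfiguration ν.2
  have hγu : ∀ ν x, IsLimitConfiguration L W x ν.1 → γ ν = x := fun ν x h =>
    (hγ ν).unique hLH hne h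
  have hγc : ∀ x, γ (configuration W x) = x := fun x =>
    hγu _ _ (isLimitConfiguration_of_eq_nuW W x rfl)
  have hcont : Continuous γ := by
    rw [continuous_iff_isClosed]
    intro C hC
    have hg : IsClosed {p : ((G × H) ⧸ L) × MW L W |
        p.1 ∈ C ∧ IsLimitConfiguration L W p.1 p.2.1} :=
      (hC.preimage continuous_fst).inter
        ((isClosed_setOf_isLimitConfiguration (L := L) (W := W)).preimage
          (continuous_fst.prodMk (continuous_subtype_val.comp continuous_snd)))
    convert isClosedMap_snd_of_compactSpace _ hg using 1
    ext ν
    constructor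
    · exact fun h => ⟨(γ ν, ν), ⟨h, hγ ν⟩, rfl⟩
    · rintro ⟨⟨x, _⟩, ⟨hx, h⟩, rfl⟩
      rwa [mem_preimage, hγu _ _ h]
  have hT := (isTopDynSystem_torusAct L).continuous_act
  have hS := (isTopDynSystem_actMW (L := L) W).continuous_act
  obtain ⟨hG, hD⟩ := isGδ_dense_setOf_notMem_frontier (L := L) hW hbd
  refine ⟨γ, ⟨hcont, fun x => ⟨_, hγc x⟩, fun g => ?_⟩, _, hG, hD, fun x hx => ?_⟩
  · refine congrFun ((denseRange_configuration W).equalizer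
      (hcont.comp (hS.comp (Continuous.prodMk_right g)))
      ((hT.comp (Continuous.prodMk_right g)).comp hcont) (funext fun x => ?_))
    simp only [Function.comp_apply, actMW_configuration, hγc]
  · refine ⟨configuration W x, hγc x, fun ν hν => Subtype.ext (Subtype.ext ?_)⟩
    have h1 : IsLimitConfiguration L W x ν.1 := hν ▸ hγ ν
    have h2 : IsLimitConfiguration L W x (configuration W x).1 :=
      isLimitConfiguration_of_eq_nuW W x rfl
    refine measure_ext_of_countable ((countable_coset x).mono fun _ h => h.1)
      h1.measure_compl h2.measure_compl fun y hy => ?_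
    have hyW : y.2 ∈ interior W := by
      by_contra hn
      exact hx y hy.1 ⟨hy.2, hn⟩
    rw [h1.measure_singleton hy.1 hyW, h2.measure_singleton hy.1 hyW]

/-! ### Projection to `G` -/

lemma integral_map_fst_eq {μ : Measure (G × H)} {K : Set H} (hμ : μ (Prod.snd ⁻¹' K)ᶜ = 0)
    (f : C_c(G, ℝ)) {χ : C_c(H, ℝ)} (hχ : ∀ h ∈ K, χ h = 1) :
    ∫ g, f g ∂(μ.map Prod.fst) = ∫ y, f y.1 * χ y.2 ∂μ := by
  refine (integral_map measurable_fst.aemeasurable f.continuous.aestronglyMeasurable).trans ?_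
  refine integral_congr_ae ?_
  filter_upwards [compl_mem_ae_iff.2 hμ] with y hy
  simp only [compl_compl, mem_preimage] at hy
  simp [hχ _ hy]

lemma hasCompactSupport_mul_fst_snd (f : C_c(G, ℝ)) (χ : C_c(H, ℝ)) :
    HasCompactSupport fun y : G × H => f y.1 * χ y.2 := by
  refine HasCompactSupport.intro (f.hasCompactSupport.isCompact.prod χ.hasCompactSupport.isCompact)
    fun y hy => ?_
  rcases not_and_or.1 hy with h | h
  · simp [image_eq_zero_of_notMem_tsupport h]
  · simp [image_eq_zero_of_notMem_tsupport h]

lemma isLocallyFiniteMeasure_map_fst {K : Set H} (hK : IsCompact K) (μ : Measure (G × H))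
    [IsLocallyFiniteMeasure μ] (hμ : μ (Prod.snd ⁻¹' K)ᶜ = 0) :
    IsLocallyFiniteMeasure (μ.map Prod.fst) := by
  refine ⟨fun p => ?_⟩
  obtain ⟨Q, hQ, hpQ⟩ := exists_compact_mem_nhds p
  refine ⟨Q, hpQ, ?_⟩
  rw [Measure.map_apply measurable_fst hQ.measurableSet, ← measure_inter_conull hμ]
  exact (hQ.prod hK).measure_lt_top

lemma measure_snd_preimage_compl_eq_zero [DiscreteTopology L] [CompactSpace ((G × H) ⧸ L)]
    {μ : LFMeasure (G × H)} (hμ : μ ∈ MW L W) : μ.1 (Prod.snd ⁻¹' closure W)ᶜ = 0 := by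
  obtain ⟨x, hx⟩ := exists_isLimitConfiguration hμ
  exact measure_mono_null (compl_subset_compl.2 fun y hy => hy.2) hx.measure_compl

/-- If two limit configurations have the same projection to `G`, then each atom of the first one in
`G × interior W` has a counterpart for the second one with the same first coordinate. -/
lemma IsLimitConfiguration.exists_fst_eq [DiscreteTopology L]
    {μ μ' : LFMeasure (G × H)} {x' : (G × H) ⧸ L} (hμ : IsLimitConfiguration L W x μ)
    (hμ' : IsLimitConfiguration L W x' μ') (heq : μ.1.map Prod.fst = μ'.1.map Prod.fst)
    {y : G × H} (hyx : (y : (G × H) ⧸ L) = x) (hyW : y.2 ∈ interior W) :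
    ∃ y' : G × H, y'.1 = y.1 ∧ (y' : (G × H) ⧸ L) = x' ∧ y'.2 ∈ closure W := by
  have h1 : μ'.1 (Prod.fst ⁻¹' {y.1}) ≠ 0 := by
    rw [← Measure.map_apply measurable_fst (measurableSet_singleton _), ← heq,
      Measure.map_apply measurable_fst (measurableSet_singleton _)]
    intro h0
    have := measure_mono_null (singleton_subset_iff.2 (by simp)) h0 (s := {y})
    rw [hμ.measure_singleton hyx hyW] at this
    exact one_ne_zero this
  exact hμ'.mem_of_measure_ne_zero h1

/-- Let `μ` and `μ'` belong to `x` and `x' = x + (0, h)`, and have the same projection to `G`.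
As `L` projects injectively to `G`, the counterpart for `μ'` of an atom of `μ` in
`G × interior W` is its translate by `(0, h)`. -/
lemma IsLimitConfiguration.image_interior_subset [DiscreteTopology L]
    (hLG : Set.InjOn (Prod.fst : G × H → G) (L : Set (G × H)))
    (hLH : Dense ((Prod.snd : G × H → H) '' (L : Set (G × H))))
    {μ μ' : LFMeasure (G × H)} {h : H} (hμ : IsLimitConfiguration L W x μ)
    (hμ' : IsLimitConfiguration L W (x + (((0, h) : G × H) : (G × H) ⧸ L)) μ')
    (heq : μ.1.map Prod.fst = μ'.1.map Prod.fst) :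
    (fun z => h + z) '' interior W ⊆ closure W := by
  rintro _ ⟨w, hw, rfl⟩
  rw [mem_closure_iff_nhds]
  intro U hU
  obtain ⟨O, hOU, hO, hwO⟩ := mem_nhds_iff.1
    ((by fun_prop : Continuous fun z : H => h + z).continuousAt.preimage_mem_nhds hU)
  -- points of `x` whose second coordinate lies in `interior W` close to `w`
  obtain ⟨y, hyx, hyO, hyW⟩ := exists_mem_coset_snd_mem hLH x (hO.inter isOpen_interior)
    ⟨w, hwO, hw⟩
  suffices hmem : h + y.2 ∈ closure W from
    mem_closure_iff_nhds.1 hmem U (mem_of_superset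
      ((hO.preimage (by fun_prop : Continuous fun z : H => -h + z)).mem_nhds (by simpa using hyO))
      fun z hz => by simpa using hOU hz)
  obtain ⟨y', hy', hy'x, hy'W⟩ := hμ.exists_fst_eq hμ' heq hyx hyW
  have hL : -(y + (0, h)) + y' ∈ L := by
    rw [← QuotientAddGroup.eq, QuotientAddGroup.mk_add, hyx, hy'x]
  have hfst : (-(y + (0, h)) + y').1 = (0 : G × H).1 := by
    simp only [Prod.fst_add, Prod.fst_neg, add_zero, Prod.fst_zero]
    rw [hy', neg_add_cancel]
  have := neg_add_eq_zero.1 (hLG hL L.zero_mem hfst)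
  rw [← this] at hy'W
  simpa [add_comm] using hy'W

/-- The configuration is determined by its projection to `G`: two limit configurations with the
same projection belong to points of the torus that differ by some `(0, h)`, and `h` is a period of
`interior (closure W)`. -/
lemma eq_of_map_fst_eq [DiscreteTopology L] [CompactSpace ((G × H) ⧸ L)]
    (hLG : Set.InjOn (Prod.fst : G × H → G) (L : Set (G × H)))
    (hLH : Dense ((Prod.snd : G × H → H) '' (L : Set (G × H))))
    (hbd : IsNowhereDense (frontier W)) (hne : (interior W).Nonempty)
    (haper : IsAperiodic (interior (closure W)))
    {μ μ' : LFMeasure (G × H)} (hμ : μ ∈ MW L W) (hμ' : μ' ∈ MW L W)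
    (heq : μ.1.map Prod.fst = μ'.1.map Prod.fst) : μ = μ' := by
  obtain ⟨x, hx⟩ := exists_isLimitConfiguration hμ
  obtain ⟨x', hx'⟩ := exists_isLimitConfiguration hμ'
  obtain ⟨y, hyx, hyW⟩ := exists_mem_coset_snd_mem hLH x isOpen_interior hne
  obtain ⟨y', hy', hy'x, -⟩ := hx.exists_fst_eq hx' heq hyx hyW
  obtain ⟨h, hh⟩ : ∃ h : H, y' = y + (0, h) :=
    ⟨-y.2 + y'.2, Prod.ext (by simpa using hy') (by simp)⟩
  have hxx' : x' = x + (((0, h) : G × H) : (G × H) ⧸ L) := by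
    rw [← hy'x, hh, QuotientAddGroup.mk_add, hyx]
  have hx'x : x = x' + (((0, -h) : G × H) : (G × H) ⧸ L) := by
    have : ((0, h) : G × H) + (0, -h) = 0 := by simp
    rw [hxx', add_assoc, ← QuotientAddGroup.mk_add, this]
    exact (add_zero x).symm
  -- as `interior W` is dense in `interior (closure W)`, its translates inside `closure W` extend
  have key : ∀ k : H, (fun z => k + z) '' interior W ⊆ closure W →
      (fun z => k + z) '' interior (closure W) ⊆ interior (closure W) := by
    intro k hk
    refine interior_maximal ?_ ((Homeomorph.addLeft k).isOpenMap _ isOpen_interior)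
    refine (image_mono (interior_closure_subset_closure_interior hbd)).trans ?_
    refine (image_closure_subset_closure_image (by fun_prop)).trans ?_
    exact isClosed_closure.closure_subset_iff.2 hk
  have hh1 := key h (hx.image_interior_subset hLG hLH (hxx' ▸ hx') heq)
  have hh2 := key (-h) (hx'.image_interior_subset hLG hLH (hx'x ▸ hx) heq.symm)
  have hh0 : h = 0 := by
    refine haper h (hh1.antisymm fun z hz => ?_)
    exact ⟨-h + z, hh2 ⟨z, hz, rfl⟩, by simp⟩
  obtain rfl : x' = x := by
    rw [hxx', hh0]
    exact add_zero x
  refine Subtype.ext (measure_ext_of_countable ((countable_coset x').mono fun _ h => h.1)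
    hx.measure_compl hx'.measure_compl fun a ha => ?_)
  -- each fibre of the projection to `G` contains at most one point of `x'`
  have hfib : ∀ ρ : LFMeasure (G × H), IsLimitConfiguration L W x' ρ →
      ρ.1 {a} = ρ.1.map Prod.fst {a.1} := by
    intro ρ hρ
    rw [Measure.map_apply measurable_fst (measurableSet_singleton _),
      ← measure_inter_conull (s := Prod.fst ⁻¹' {a.1}) hρ.measure_compl]
    congr 1
    ext b
    constructor
    · rintro rfl
      exact ⟨rfl, ha⟩
    · rintro ⟨hb, hbx, -⟩
      have hL : -a + b ∈ L := QuotientAddGroup.eq.1 (ha.1.trans hbx.symm)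
      have hfst : (-a + b).1 = (0 : G × H).1 := by
        simp only [Prod.fst_add, Prod.fst_neg, Prod.fst_zero]
        rw [show b.1 = a.1 from hb, neg_add_cancel]
      exact (neg_add_eq_zero.1 (hLG hL L.zero_mem hfst)).symm
  rw [hfib μ hx, hfib μ' hx', heq]

/-- The projection to `G`, as a map on `MW L W`. -/
noncomputable def projMW [DiscreteTopology L] [CompactSpace ((G × H) ⧸ L)]
    (hW : IsCompact (closure W)) (ν : MW L W) : LFMeasure G :=
  ⟨ν.1.1.map Prod.fst,
    isLocallyFiniteMeasure_map_fst hW ν.1.1 (measure_snd_preimage_compl_eq_zero ν.2)⟩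

lemma continuous_projMW [DiscreteTopology L] [CompactSpace ((G × H) ⧸ L)]
    (hW : IsCompact (closure W)) : Continuous (projMW hW : MW L W → LFMeasure G) := by
  refine continuous_induced_rng.2 (continuous_pi fun f => ?_)
  obtain ⟨χ, hχ, -⟩ := exists_compactlySupported_eq_one hW isOpen_univ (subset_univ _)
  have hc : Continuous fun y : G × H => f y.1 * χ y.2 :=
    (f.continuous.comp continuous_fst).mul (χ.continuous.comp continuous_snd)
  refine ((LFMeasure.continuous_integral ⟨⟨_, hc⟩, hasCompactSupport_mul_fst_snd f χ⟩).comp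
    continuous_subtype_val).congr fun ν => ?_
  exact (integral_map_fst_eq (measure_snd_preimage_compl_eq_zero ν.2) f hχ).symm

lemma range_projMW [DiscreteTopology L] [CompactSpace ((G × H) ⧸ L)]
    (hW : IsCompact (closure W)) : range (projMW hW : MW L W → LFMeasure G) = MWG L W := by
  have : CompactSpace (MW L W) := isCompact_iff_compactSpace.1 (isCompact_MW W)
  have hc := continuous_projMW (L := L) hW
  apply Subset.antisymm
  · refine (hc.range_subset_closure_image_dense (denseRange_configuration W)).trans
      (closure_mono ?_)
    rintro _ ⟨_, ⟨x, rfl⟩, rfl⟩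
    exact ⟨x, rfl⟩
  · refine (isCompact_range hc).isClosed.closure_subset_iff.2 ?_
    rintro μ ⟨x, hx⟩
    exact ⟨configuration W x, Subtype.ext hx.symm⟩

lemma isTopDynSystem_actMWG [DiscreteTopology L] [CompactSpace ((G × H) ⧸ L)]
    (hW : IsCompact (closure W)) : IsTopDynSystem (actMWG L W) := by
  have : CompactSpace (MW L W) := isCompact_iff_compactSpace.1 (isCompact_MW W)
  have hK : IsCompact (MWG L W) := range_projMW (L := L) hW ▸
    isCompact_range (continuous_projMW hW)
  exact
    { compact := isCompact_iff_compactSpace.1 hK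
      t2 := inferInstance
      zero_act := fun ν => Subtype.ext (LFMeasure.translate_zero ν.1)
      add_act := fun g g' ν => Subtype.ext (LFMeasure.translate_add g g' ν.1)
      continuous_act := (LFMeasure.continuous_translate_of_isCompact hK).subtype_mk _ }

lemma exists_isTopIsomorphism_projection [DiscreteTopology L] [CompactSpace ((G × H) ⧸ L)]
    (hLG : Set.InjOn (Prod.fst : G × H → G) (L : Set (G × H)))
    (hLH : Dense ((Prod.snd : G × H → H) '' (L : Set (G × H))))
    (hW : IsCompact (closure W)) (hbd : IsNowhereDense (frontier W)) (hne : (interior W).Nonempty)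
    (haper : IsAperiodic (interior (closure W))) :
    ∃ Φ : MW L W → MWG L W, IsTopIsomorphism (actMW L W) (actMWG L W) Φ ∧
      ∀ ν : MW L W, (Φ ν).1.1 = ν.1.1.map Prod.fst := by
  have : CompactSpace (MW L W) := isCompact_iff_compactSpace.1 (isCompact_MW W)
  have hmem : ∀ ν : MW L W, projMW hW ν ∈ MWG L W := fun ν =>
    range_projMW (L := L) hW ▸ mem_range_self ν
  refine ⟨fun ν => ⟨projMW hW ν, hmem ν⟩, ⟨?_, fun g ν => ?_⟩, fun ν => rfl⟩
  · rw [isHomeomorph_iff_continuous_bijective]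
    refine ⟨(continuous_projMW hW).subtype_mk _, fun ν ν' h => Subtype.ext ?_, fun ρ => ?_⟩
    · exact eq_of_map_fst_eq hLG hLH hbd hne haper ν.2 ν'.2
        (congrArg Subtype.val (congrArg Subtype.val h))
    · have hρ : ρ.1 ∈ range (projMW hW : MW L W → LFMeasure G) := by
        rw [range_projMW]
        exact ρ.2
      obtain ⟨ν, hν⟩ := hρ
      exact ⟨ν, Subtype.ext hν⟩
  · refine Subtype.ext (Subtype.ext ?_)
    change (ν.1.1.map fun y => ((g, 0) : G × H) + y).map Prod.fst =
      (ν.1.1.map Prod.fst).map fun y => g + y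
    rw [Measure.map_map measurable_fst (by fun_prop), Measure.map_map (by fun_prop) measurable_fst]
    rfl

end Hulls

theorem mainTheorem8
    {G : Type u} {H : Type v}
    [AddCommGroup G] [TopologicalSpace G] [IsTopologicalAddGroup G] [T2Space G]
    [LocallyCompactSpace G] [SecondCountableTopology G] [MeasurableSpace G] [BorelSpace G]
    [AddCommGroup H] [TopologicalSpace H] [IsTopologicalAddGroup H] [T2Space H]
    [LocallyCompactSpace H] [SecondCountableTopology H] [MeasurableSpace H] [BorelSpace H]
    -- a cocompact lattice, projecting injectively to `G` and densely to `H`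
    (L : AddSubgroup (G × H)) [DiscreteTopology L] [CompactSpace ((G × H) ⧸ L)]
    (hLG : Set.InjOn (Prod.fst : G × H → G) (L : Set (G × H)))
    (hLH : Dense ((Prod.snd : G × H → H) '' (L : Set (G × H))))
    (W : Set H) (hW : IsCompact (closure W)) (hbd : IsNowhereDense (frontier W))
    (hne : (interior (closure W)).Nonempty) (haper : IsAperiodic (interior (closure W))) :
    -- the objects are topological dynamical systems
    IsTopDynSystem (torusAct L) ∧ IsTopDynSystem (actMW L W) ∧ IsTopDynSystem (actMWG L W) ∧
    -- a) isomorphism, induced by the projection to `G`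
    (∃ Φ : MW L W → MWG L W, IsTopIsomorphism (actMW L W) (actMWG L W) Φ ∧
      ∀ ν : MW L W, (Φ ν).1.1 = ν.1.1.map Prod.fst) ∧
    (∃ γ : MW L W → (G × H) ⧸ L,
      IsAlmostOneToOneExtension (actMW L W) (torusAct L) γ ∧
      IsMaximalEquicontinuousFactor.{w} (actMW L W) (torusAct L) γ) ∧
    (∃ Γ : MWG L W → (G × H) ⧸ L,
      IsAlmostOneToOneExtension (actMWG L W) (torusAct L) Γ ∧
      IsMaximalEquicontinuousFactor.{w} (actMWG L W) (torusAct L) Γ ∧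
      -- b) nonempty closed invariant subsets
      ∀ (M : Set (MWG L W)) (hM : ∀ g : G, Set.MapsTo (actMWG L W g) M M),
        M.Nonempty → IsClosed M →
          IsAlmostOneToOneExtension (fun g => (hM g).restrict) (torusAct L) (M.domRestrict Γ) ∧
          IsMaximalEquicontinuousFactor.{w} (fun g => (hM g).restrict) (torusAct L)
            (M.domRestrict Γ)) := by
  have hintne : (interior W).Nonempty :=
    closure_nonempty_iff.1 (hne.mono (interior_closure_subset_closure_interior hbd))
  have hX := isTopDynSystem_torusAct L
  have hXe := isEquicontinuousAction_torusAct L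
  have hXm := dense_range_torusAct L hLH
  have hMW := isTopDynSystem_actMW (L := L) W
  have hMWG := isTopDynSystem_actMWG (L := L) hW
  have := hMW.compact
  have := hMWG.compact
  obtain ⟨Φ, hΦ, hΦν⟩ := exists_isTopIsomorphism_projection hLG hLH hW hbd hintne haper
  obtain ⟨γ, hγ⟩ := exists_isAlmostOneToOneExtension_torus (L := L) hLH hW hbd hintne
  obtain ⟨Γ, hΓ⟩ := hΦ.isAlmostOneToOneExtension_symm hγ
  refine ⟨hX, hMW, hMWG, ⟨Φ, hΦ, hΦν⟩, ⟨γ, hγ, hγ.isMaximalEquicontinuousFactor hX hXe hXm⟩,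
    ⟨Γ, hΓ, hΓ.isMaximalEquicontinuousFactor hX hXe hXm, fun M hM hMne hMc => ?_⟩⟩
  have := isCompact_iff_compactSpace.1 hMc.isCompact
  have hr := hΓ.restrict hXm hM hMne hMc
  exact ⟨hr, hr.isMaximalEquicontinuousFactor hX hXe hXm⟩
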